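/- **Definitions.** A digraph $(V,E)$ with vertex set $V$ of any cardinality is *well-founded* if there is no infinite chain $v_0\leftarrow v_1\leftarrow v_2\leftarrow\cdots$ of edges. For $v\in V$ let $\mathrm{pa}(v)=\{u\in V: u\to v\}$ be the set of parents of $v$, and let $\mathrm{nd}(v)$ be the set of non-descendants of $v$, that is, of all $u\in V$ that cannot be reached from $v$ by a directed path (the trivial path of length $0$ is allowed, so $v\notin\mathrm{nd}(v)$). A *measure-theoretic Bayesian network* $M=(V,E,\{\mathcal X_v\}_{v\in V},\{K_v\}_{v\in V})$ consists of a well-founded digraph $(V,E)$, an arbitrary measurable space $\mathcal X_v$ for each $v\in V$, and a probability kernel $K_v$ from the product space $\mathcal X_{\mathrm{pa}(v)}=\prod_{u\in\mathrm{pa}(v)}\mathcal X_u$ to $\mathcal X_v$ for each $v\in V$. For $U\subseteq V$ let $\mathcal X_U=\prod_{u\in U}\mathcal X_u$, with the product $\sigma$-algebra, and let $X_U:\mathcal X_V\to\mathcal X_U$ be the projection; write $X_v$ for the coordinate of $v$. The network $M$ *represents* a probability measure $\mu$ on $\mathcal X_V$ if for every $v\in V$: 1. $X_v$ is conditionally independent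 of $X_{\mathrm{nd}(v)}$ given $X_{\mathrm{pa}(v)}$ under $\mu$, that is, $\mathbb P_\mu[A\cap B\mid X_{\mathrm{pa}(v)}]=\mathbb P_\mu[A\mid X_{\mathrm{pa}(v)}]\,\mathbb P_\mu[B\mid X_{\mathrm{pa}(v)}]$ almost surely for all $A\in\sigma(X_v)$ and $B\in\sigma(X_{\mathrm{nd}(v)})$; 2. $K_v(X_{\mathrm{pa}(v)},A)=\mathbb P_\mu[X_v\in A\mid X_{\mathrm{pa}(v)}]$ almost surely for every measurable $A\subseteq\mathcal X_v$, that is, $K_v$ is a version of the conditional distribution of $X_v$ given its parents. **Theorem.** For every measure-theoretic Bayesian network $M$ there is exactly one probability measure $\mu$ on $\mathcal X_V$ that $M$ represents. -/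

import Mathlib

open MeasureTheory ProbabilityTheory

/-- The set of parents of a vertex `v` of a digraph. -/
def Digraph.parents {V : Type*} (G : Digraph V) (v : V) : Set V :=
  {u | G.Adj u v}

/-- The set of non-descendants of a vertex `v` of a digraph: the vertices that cannot be reached
from `v` by a directed path. The trivial path counts, so `v` is not its own non-descendant. -/
def Digraph.nonDescendants {V : Type*} (G : Digraph V) (v : V) : Set V :=
  {u | ¬ Relation.ReflTransGen G.Adj v u}

/-- A digraph is well-founded if it has no infinite ancestor chain `v₀ ← v₁ ← v₂ ← ⋯`. -/
def Digraph.WellFoundedDigraph {V : Type*} (G : Digraph V) : Prop :=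
  ¬ ∃ s : ℕ → V, ∀ n : ℕ, G.Adj (s (n + 1)) (s n)

/-- The `σ`-algebras `m₁` and `m₂` are conditionally independent given the `σ`-algebra `m`:
`P(A ∩ B | m) = P(A | m) P(B | m)` almost surely for all `A ∈ m₁` and `B ∈ m₂`. The conditional
probabilities are conditional expectations of indicators, so that no regularity of the space
is needed. -/
def CondIndepSigma {Ω : Type*} (m m₁ m₂ : MeasurableSpace Ω) [mΩ : MeasurableSpace Ω]
    (μ : Measure Ω) : Prop :=
  ∀ A B : Set Ω, MeasurableSet[m₁] A → MeasurableSet[m₂] B →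
    μ⟦A ∩ B|m⟧ =ᵐ[μ] μ⟦A|m⟧ * μ⟦B|m⟧

/-- The random variables `f` and `g` are conditionally independent given the random variable `h`:
the `σ`-algebras generated by `f` and by `g` are so given the one generated by `h`. -/
def CondIndepVar {Ω α β γ : Type*} [MeasurableSpace Ω] [mα : MeasurableSpace α]
    [mβ : MeasurableSpace β] [mγ : MeasurableSpace γ]
    (f : Ω → α) (g : Ω → β) (h : Ω → γ) (μ : Measure Ω) : Prop :=
  CondIndepSigma (mγ.comap h) (mα.comap f) (mβ.comap g) μ

/-- A measure-theoretic Bayesian network with vertex set `V` and measurable spaces `X v`. -/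
structure MTBN (V : Type*) (X : V → Type*) [∀ v, MeasurableSpace (X v)] where
  /-- the digraph -/
  graph : Digraph V
  /-- the digraph has no infinite ancestor chain -/
  wellFounded : graph.WellFoundedDigraph
  /-- the kernel of `v`, from the product of the spaces of the parents of `v` to the space of `v` -/
  kernel : ∀ v : V, Kernel (∀ u : graph.parents v, X u) (X v)
  /-- the kernels are probability kernels -/
  isMarkovKernel : ∀ v : V, IsMarkovKernel (kernel v)

namespace MTBN

/-- The network `M` represents the measure `μ` on the product of all the spaces `X v` if, for each
vertex `v`, the coordinate of `v` is conditionally independent of the family of coordinates of the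
non-descendants of `v` given the family of coordinates of the parents of `v`, and the kernel of `v`
is a version of the conditional distribution of the coordinate of `v` given those of its parents.
Here `S.domRestrict` maps a point `x` to its family of coordinates `(x u)` with `u ∈ S`. -/
def Represents {V : Type*} {X : V → Type*} [∀ v, MeasurableSpace (X v)]
    (M : MTBN V X) (μ : Measure (∀ v, X v)) : Prop :=
  ∀ v : V,
    CondIndepVar (fun x : ∀ u, X u => x v) (M.graph.nonDescendants v).domRestrict
      (M.graph.parents v).domRestrict μ ∧
    ∀ A : Set (X v), MeasurableSet A →
      (fun x : ∀ u, X u => (M.kernel v ((M.graph.parents v).domRestrict x)).real A) =ᵐ[μ]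
        μ⟦(fun x : ∀ u, X u => x v) ⁻¹' A|
          MeasurableSpace.comap (M.graph.parents v).domRestrict inferInstance⟧

end MTBN

/-! ### Events depending on a set of coordinates -/

section CylinderEvents

variable {V : Type*} {X : V → Type*} [∀ v, MeasurableSpace (X v)]

/-! Well-foundedness lets the edge relation be extended to a well-order, in which parents come
first. For such an order, `M` represents `μ` iff each coordinate, given all earlier ones, is drawn
from its kernel (`MTBN.represents_iff_isInterventionLaw`). One direction holds because earlier
vertices are non-descendants. The other must also condition on later non-descendants;
`IsInterventionLaw.inter_eval_of_forall_measurable` allows this, since parents of non-descendants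
are again non-descendants.

Uniqueness is transfinite induction with π-systems (`measure_eq_of_forall_inter_eval`).

Existence is a transfinite Ionescu-Tulcea theorem; the spaces are arbitrary, so no regularity can be
used. For a set `T`, one constructs a kernel that redraws the coordinates in `T` and keeps the
others, so that kernels of successive blocks compose (`IsInterventionLaw.bind`). Countably many
successive blocks are the steps of a Markov chain on the whole product (`exists_kernel_iUnion`). For
uncountable cofinality, each event involves only countably many coordinates, so the compatible laws
already constructed glue to a measure (`exists_kernel_of_forall_sequence`). -/

theorem cylinderEvents_eq_comap_domRestrict (D : Set V) :
    cylinderEvents (X := X) D = MeasurableSpace.comap D.domRestrict inferInstance := by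
  rw [cylinderEvents, MeasurableSpace.pi, MeasurableSpace.comap_iSup, iSup_subtype']
  simp only [MeasurableSpace.comap_comp]
  rfl

theorem comap_eval_le_cylinderEvents {D : Set V} {v : V} (hv : v ∈ D) :
    MeasurableSpace.comap (fun x : ∀ u, X u => x v) inferInstance ≤ cylinderEvents D :=
  le_iSup₂_of_le v hv le_rfl

theorem measurableSet_cylinderEvents_eval {D : Set V} {v : V} (hv : v ∈ D) {B : Set (X v)}
    (hB : MeasurableSet B) :
    MeasurableSet[cylinderEvents D] ((fun x : ∀ u, X u => x v) ⁻¹' B) :=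
  comap_eval_le_cylinderEvents hv _ ⟨B, hB, rfl⟩

/-- An induction principle for cylinder events: it suffices to treat coordinate events. -/
theorem cylinderEvents_induction {D : Set V} {p : Set (∀ v, X v) → Prop}
    (eval : ∀ v ∈ D, ∀ B : Set (X v), MeasurableSet B → p ((fun x => x v) ⁻¹' B))
    (empty : p ∅)
    (compl : ∀ A, MeasurableSet[cylinderEvents D] A → p A → p Aᶜ)
    (iUnion : ∀ f : ℕ → Set (∀ v, X v), (∀ n, MeasurableSet[cylinderEvents D] (f n)) →
      (∀ n, p (f n)) → p (⋃ n, f n))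
    {A : Set (∀ v, X v)} (hA : MeasurableSet[cylinderEvents D] A) : p A := by
  have hgen : cylinderEvents (X := X) D = MeasurableSpace.generateFrom
      {A | ∃ v ∈ D, ∃ B : Set (X v), MeasurableSet B ∧ (fun x => x v) ⁻¹' B = A} := by
    refine le_antisymm (iSup₂_le fun v hv => ?_) (MeasurableSpace.generateFrom_le ?_)
    · rintro _ ⟨B, hB, rfl⟩
      exact MeasurableSpace.measurableSet_generateFrom ⟨v, hv, B, hB, rfl⟩
    · rintro _ ⟨v, hv, B, hB, rfl⟩
      exact measurableSet_cylinderEvents_eval hv hB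
  have key : MeasurableSet[cylinderEvents D] A ∧ p A := by
    have hA' := hA
    rw [hgen] at hA'
    induction A, hA' using MeasurableSpace.generateFrom_induction with
    | hC t ht _ =>
      obtain ⟨v, hv, B, hB, rfl⟩ := ht
      exact ⟨hA, eval v hv B hB⟩
    | empty => exact ⟨hA, empty⟩
    | compl t ht ih =>
      have := @MeasurableSet.compl _ _ (cylinderEvents D) hA
      rw [compl_compl] at this
      exact ⟨hA, compl t this (ih this).2⟩
    | iUnion f hf ih =>
      have h : ∀ n, MeasurableSet[cylinderEvents D] (f n) := by rw [hgen]; exact hf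
      exact ⟨hA, iUnion f h fun n => (ih n (h n)).2⟩
  exact key.2

open Set in
/-- If the coordinates in `D` of `f` and `g` agree almost
surely, as events, then so do all cylinder events on `D`. -/
theorem ae_iff_preimage_of_forall_eval {Ω : Type*} [MeasurableSpace Ω] {P : Measure Ω}
    {f g : Ω → ∀ v, X v} {D : Set V}
    (h : ∀ v ∈ D, ∀ B : Set (X v), MeasurableSet B → ∀ᵐ ω ∂P, (f ω v ∈ B ↔ g ω v ∈ B))
    {A : Set (∀ v, X v)} (hA : MeasurableSet[cylinderEvents D] A) :
    ∀ᵐ ω ∂P, (f ω ∈ A ↔ g ω ∈ A) := by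
  refine cylinderEvents_induction (p := fun A => ∀ᵐ ω ∂P, (f ω ∈ A ↔ g ω ∈ A)) h (by simp) ?_ ?_ hA
  · intro A _ ih
    filter_upwards [ih] with ω hω using not_congr hω
  · intro s _ ih
    filter_upwards [ae_all_iff.2 ih] with ω hω
    simp only [mem_iUnion, hω]

theorem measure_preimage_eq_of_forall_eval {Ω : Type*} [MeasurableSpace Ω] {P : Measure Ω}
    {f g : Ω → ∀ v, X v} {D : Set V}
    (h : ∀ v ∈ D, ∀ B : Set (X v), MeasurableSet B → ∀ᵐ ω ∂P, (f ω v ∈ B ↔ g ω v ∈ B))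
    {A : Set (∀ v, X v)} (hA : MeasurableSet[cylinderEvents D] A) :
    P (f ⁻¹' A) = P (g ⁻¹' A) := by
  refine measure_congr ?_
  filter_upwards [ae_iff_preimage_of_forall_eval h hA] with ω hω
  exact propext hω

end CylinderEvents

/-! ### Agreement of measures by transfinite induction -/

section Agreement

theorem lintegral_eq_of_forall_measurableSet {Ω : Type*} {m m₀ : MeasurableSpace Ω} (hm : m ≤ m₀)
    {μ ν : Measure Ω} (h : ∀ A, MeasurableSet[m] A → μ A = ν A) {f : Ω → ENNReal}
    (hf : Measurable[m] f) : ∫⁻ x, f x ∂μ = ∫⁻ x, f x ∂ν := by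
  have : μ.trim hm = ν.trim hm := by
    refine @Measure.ext _ m _ _ fun A hA => ?_
    rw [trim_measurableSet_eq hm hA, trim_measurableSet_eq hm hA, h A hA]
  rw [← lintegral_trim hm hf, ← lintegral_trim hm hf, this]

theorem setLIntegral_eq_of_forall_measurableSet {Ω : Type*} {m m₀ : MeasurableSpace Ω} (hm : m ≤ m₀)
    {μ ν : Measure Ω} (h : ∀ A, MeasurableSet[m] A → μ A = ν A) {f : Ω → ENNReal}
    (hf : Measurable[m] f) {A : Set Ω} (hA : MeasurableSet[m] A) :
    ∫⁻ x in A, f x ∂μ = ∫⁻ x in A, f x ∂ν := by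
  refine lintegral_eq_of_forall_measurableSet hm (fun C hC => ?_) hf
  rw [Measure.restrict_apply (hm _ hC), Measure.restrict_apply (hm _ hC), h _ (hC.inter hA)]

variable {V : Type*} [LinearOrder V] {X : V → Type*} [∀ v, MeasurableSpace (X v)]

open Set

/-- Since the order is linear, the events that look at `D` only up to one of its members form a
π-system. -/
theorem measure_eq_of_forall_inter_Iic {D : Set V} {ρ₁ ρ₂ : Measure (∀ v, X v)} [IsFiniteMeasure ρ₁]
    (huniv : ρ₁ univ = ρ₂ univ)
    (h : ∀ w ∈ D, ∀ A, MeasurableSet[cylinderEvents (D ∩ Iic w)] A → ρ₁ A = ρ₂ A)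
    {A : Set (∀ v, X v)} (hA : MeasurableSet[cylinderEvents D] A) : ρ₁ A = ρ₂ A := by
  refine ext_on_measurableSpace_of_generate_finite MeasurableSpace.pi
    {A | ∃ w ∈ D, MeasurableSet[cylinderEvents (D ∩ Iic w)] A} (fun s ⟨w, hw, hs⟩ => h w hw s hs)
    cylinderEvents_le_pi ?_ ?_ huniv hA
  · refine le_antisymm (iSup₂_le fun v hv => ?_) (MeasurableSpace.generateFrom_le ?_)
    · rintro _ ⟨B, hB, rfl⟩
      refine MeasurableSpace.measurableSet_generateFrom
        ⟨v, hv, measurableSet_cylinderEvents_eval (show v ∈ D ∩ Iic v from ⟨hv, le_rfl⟩) hB⟩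
    · rintro A ⟨w, -, hA⟩
      exact cylinderEvents_mono inter_subset_left _ hA
  · rintro s ⟨v, hv, hs⟩ t ⟨w, hw, ht⟩ -
    rcases le_total v w with hvw | hvw
    · exact ⟨w, hw, MeasurableSet.inter
        (cylinderEvents_mono (inter_subset_inter_right _ (Iic_subset_Iic.2 hvw)) _ hs) ht⟩
    · exact ⟨v, hv, hs.inter
        (cylinderEvents_mono (inter_subset_inter_right _ (Iic_subset_Iic.2 hvw)) _ ht)⟩

theorem measure_eq_of_inter_eval {D : Set V} {w : V} (hw : w ∈ D) {ρ₁ ρ₂ : Measure (∀ v, X v)}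
    [IsFiniteMeasure ρ₁]
    (h : ∀ A, MeasurableSet[cylinderEvents (D ∩ Iio w)] A → ∀ B : Set (X w), MeasurableSet B →
      ρ₁ (A ∩ (fun x => x w) ⁻¹' B) = ρ₂ (A ∩ (fun x => x w) ⁻¹' B))
    {A : Set (∀ v, X v)} (hA : MeasurableSet[cylinderEvents (D ∩ Iic w)] A) : ρ₁ A = ρ₂ A := by
  refine ext_on_measurableSpace_of_generate_finite MeasurableSpace.pi
    {C | ∃ A, MeasurableSet[cylinderEvents (D ∩ Iio w)] A ∧ ∃ B : Set (X w), MeasurableSet B ∧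
      A ∩ (fun x => x w) ⁻¹' B = C} ?_
    cylinderEvents_le_pi ?_ ?_ ?_ hA
  · rintro _ ⟨A, hA, B, hB, rfl⟩
    exact h A hA B hB
  · refine le_antisymm (iSup₂_le fun v hv => ?_) (MeasurableSpace.generateFrom_le ?_)
    · rintro _ ⟨B, hB, rfl⟩
      refine MeasurableSpace.measurableSet_generateFrom ?_
      rcases eq_or_lt_of_le (show v ≤ w from hv.2) with rfl | hvw
      · exact ⟨univ, MeasurableSet.univ, B, hB, univ_inter _⟩
      · exact ⟨_, measurableSet_cylinderEvents_eval (show v ∈ D ∩ Iio w from ⟨hv.1, hvw⟩) hB, univ,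
          MeasurableSet.univ, by simp⟩
    · rintro _ ⟨A, hA, B, hB, rfl⟩
      exact MeasurableSet.inter
        (cylinderEvents_mono (inter_subset_inter_right _ Iio_subset_Iic_self) _ hA)
        (measurableSet_cylinderEvents_eval (show w ∈ D ∩ Iic w from ⟨hw, le_rfl⟩) hB)
  · rintro _ ⟨A, hA, B, hB, rfl⟩ _ ⟨A', hA', B', hB', rfl⟩ -
    exact ⟨A ∩ A', hA.inter hA', B ∩ B', hB.inter hB',
      by rw [preimage_inter, inter_inter_inter_comm]⟩
  · simpa using h univ MeasurableSet.univ univ MeasurableSet.univ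

/-- Two finite measures agree on the cylinder events on `D` if the agreement on the events before
a coordinate in `D` always extends to the intersections with the events of that coordinate. -/
theorem measure_eq_of_forall_inter_eval [WellFoundedLT V] {D : Set V} {ρ₁ ρ₂ : Measure (∀ v, X v)}
    [IsFiniteMeasure ρ₁] (huniv : ρ₁ univ = ρ₂ univ)
    (h : ∀ w ∈ D, (∀ A, MeasurableSet[cylinderEvents (D ∩ Iio w)] A → ρ₁ A = ρ₂ A) →
      ∀ A, MeasurableSet[cylinderEvents (D ∩ Iio w)] A → ∀ B : Set (X w), MeasurableSet B →
      ρ₁ (A ∩ (fun x => x w) ⁻¹' B) = ρ₂ (A ∩ (fun x => x w) ⁻¹' B))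
    {A : Set (∀ v, X v)} (hA : MeasurableSet[cylinderEvents D] A) : ρ₁ A = ρ₂ A := by
  refine measure_eq_of_forall_inter_Iic huniv (fun w => ?_) hA
  induction w using WellFoundedLT.induction with
  | ind w ih =>
    intro hw A hA
    refine measure_eq_of_inter_eval hw (h w hw fun A hA => ?_) hA
    -- Agreement up to each earlier coordinate gives agreement strictly before `w`, so successors
    -- and limits need no separate treatment.
    refine measure_eq_of_forall_inter_Iic huniv (fun u hu A hA => ih u hu.2 hu.1 A ?_) hA
    exact cylinderEvents_mono (inter_subset_inter_left _ inter_subset_left) _ hA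

end Agreement

/-! ### Intervention laws: uniqueness, composition, one coordinate -/

section InterventionLaw

open Set

variable {V : Type*} [LinearOrder V] {X : V → Type*} [∀ v, MeasurableSpace (X v)]

/-- The probability measure `ν` is the law of a family of coordinates such that the coordinates
outside `T` are those of `x` and each coordinate `v ∈ T` is drawn from the kernel `κ v`, given the
coordinates before `v`. -/
structure IsInterventionLaw (κ : ∀ v, Kernel (∀ u, X u) (X v)) (T : Set V) (x : ∀ v, X v)
    (ν : Measure (∀ v, X v)) : Prop where
  isProbabilityMeasure : IsProbabilityMeasure ν
  eval_of_notMem : ∀ v ∉ T, ∀ B : Set (X v), MeasurableSet B →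
    ν ((fun y => y v) ⁻¹' B) = B.indicator 1 (x v)
  inter_eval_of_mem : ∀ v ∈ T, ∀ A, MeasurableSet[cylinderEvents (Iio v)] A →
    ∀ B : Set (X v), MeasurableSet B →
    ν (A ∩ (fun y => y v) ⁻¹' B) = ∫⁻ y in A, κ v y B ∂ν

/-- The kernel `κ v` only depends on the coordinates before `v`. -/
def IsNonanticipating (κ : ∀ v, Kernel (∀ u, X u) (X v)) : Prop :=
  ∀ v, ∀ B : Set (X v), MeasurableSet B → Measurable[cylinderEvents (Iio v)] fun x => κ v x B

variable {κ : ∀ v, Kernel (∀ u, X u) (X v)} {T T' : Set V} {x : ∀ v, X v}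
  {ν ν' : Measure (∀ v, X v)}

namespace IsInterventionLaw

theorem inter_eval_of_notMem (h : IsInterventionLaw κ T x ν) {v : V} (hv : v ∉ T)
    (A : Set (∀ u, X u)) {B : Set (X v)} (hB : MeasurableSet B) :
    ν (A ∩ (fun y => y v) ⁻¹' B) = B.indicator (fun _ => ν A) (x v) := by
  have := h.isProbabilityMeasure
  by_cases hx : x v ∈ B
  · have h0 : ν ((fun y => y v) ⁻¹' B)ᶜ = 0 := by
      rw [← preimage_compl, h.eval_of_notMem v hv _ hB.compl]
      simp [hx]
    rw [indicator_of_mem hx]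
    exact measure_inter_conull h0
  · rw [indicator_of_notMem hx]
    refine measure_mono_null inter_subset_right ?_
    rw [h.eval_of_notMem v hv _ hB, indicator_of_notMem hx]

/-- Coordinates outside `T` are copied from `x`, and a kernel used inside `D` sees only
predecessors, which `hD` keeps in `D`. This locality makes the laws for different sets `T`
compatible. -/
theorem measure_eq [WellFoundedLT V] (hκ : IsNonanticipating κ) (h : IsInterventionLaw κ T x ν)
    (h' : IsInterventionLaw κ T' x ν') {D : Set V} (hT : ∀ v ∈ D, v ∈ T ↔ v ∈ T')
    (hD : ∀ v ∈ D, v ∈ T → Iio v ⊆ D) {A : Set (∀ v, X v)}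
    (hA : MeasurableSet[cylinderEvents D] A) : ν A = ν' A := by
  have := h.isProbabilityMeasure
  have := h'.isProbabilityMeasure
  refine measure_eq_of_forall_inter_eval (by simp) (fun w hw ih A hA B hB => ?_) hA
  by_cases hwT : w ∈ T
  · rw [inter_eq_right.2 (hD w hw hwT)] at ih hA
    rw [h.inter_eval_of_mem w hwT A hA B hB, h'.inter_eval_of_mem w ((hT w hw).1 hwT) A hA B hB]
    exact setLIntegral_eq_of_forall_measurableSet cylinderEvents_le_pi ih (hκ w B hB) hA
  · rw [h.inter_eval_of_notMem hwT A hB,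
      h'.inter_eval_of_notMem (fun hc => hwT ((hT w hw).2 hc)) A hB,
      ih A hA]

theorem dirac (κ : ∀ v, Kernel (∀ u, X u) (X v)) (x : ∀ v, X v) :
    IsInterventionLaw κ ∅ x (Measure.dirac x) where
  isProbabilityMeasure := inferInstance
  eval_of_notMem v _ B hB := by
    rw [Measure.dirac_apply' _ (measurable_pi_apply v hB)]
    rfl
  inter_eval_of_mem v hv := absurd hv (notMem_empty v)

theorem measure_eq_dirac [WellFoundedLT V] (hκ : IsNonanticipating κ)
    (h : IsInterventionLaw κ T x ν) {D : Set V} (hT : Disjoint D T) {A : Set (∀ v, X v)}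
    (hA : MeasurableSet[cylinderEvents D] A) : ν A = Measure.dirac x A :=
  h.measure_eq hκ (dirac κ x) (fun v hv => by simp [disjoint_left.1 hT hv])
    (fun v hv hv' => absurd hv' (disjoint_left.1 hT hv)) hA

/-- As `T` precedes `T'`, the second draw leaves each `v ∈ T` and everything before it fixed, so the
kernel identity at `v` survives from `ν`. At `v ∈ T'` the identity for `Q y` is integrated over `y`.
-/
theorem bind [WellFoundedLT V] (hκ : IsNonanticipating κ) (h : IsInterventionLaw κ T x ν)
    {Q : Kernel (∀ v, X v) (∀ v, X v)} (hQ : ∀ y, IsInterventionLaw κ T' y (Q y))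
    (hT : ∀ s ∈ T, ∀ t ∈ T', s < t) : IsInterventionLaw κ (T ∪ T') x (ν.bind Q) := by
  have := h.isProbabilityMeasure
  have : IsMarkovKernel Q := ⟨fun y => (hQ y).isProbabilityMeasure⟩
  have hdisj : Disjoint T T' := disjoint_left.2 fun v hv hv' => lt_irrefl v (hT v hv v hv')
  refine ⟨inferInstance, fun v hv B hB => ?_, fun v hv A hA B hB => ?_⟩
  · have hB' : MeasurableSet ((fun y : ∀ u, X u => y v) ⁻¹' B) := measurable_pi_apply v hB
    rw [mem_union, not_or] at hv
    rw [Measure.bind_apply hB' Q.measurable.aemeasurable]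
    simp_rw [fun y => (hQ y).eval_of_notMem v hv.2 B hB]
    rw [← h.eval_of_notMem v hv.1 B hB, ← lintegral_indicator_one hB']
    rfl
  · have hA' : MeasurableSet A := cylinderEvents_le_pi _ hA
    have hB' : MeasurableSet ((fun y : ∀ u, X u => y v) ⁻¹' B) := measurable_pi_apply v hB
    have hf : Measurable fun y => κ v y B := (κ v).measurable_coe hB
    rw [Measure.bind_apply (hA'.inter hB') Q.measurable.aemeasurable,
      ← lintegral_indicator hA', Measure.lintegral_bind Q.measurable.aemeasurable
        (hf.indicator hA').aemeasurable]
    by_cases hv' : v ∈ T'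
    · refine lintegral_congr fun y => ?_
      rw [(hQ y).inter_eval_of_mem v hv' A hA B hB, lintegral_indicator hA']
    · have hvT : v ∈ T := hv.resolve_right hv'
      have hd : Disjoint (Iio v) T' :=
        disjoint_left.2 fun u hu hu' => lt_asymm (hT v hvT u hu') hu
      have h1 : ∀ y, ∫⁻ z, A.indicator (fun z => κ v z B) z ∂Q y =
          A.indicator (fun z => κ v z B) y := fun y => by
        rw [lintegral_eq_of_forall_measurableSet cylinderEvents_le_pi
          (fun C hC => (hQ y).measure_eq_dirac hκ hd hC) ((hκ v B hB).indicator hA),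
          lintegral_dirac' _ (hf.indicator hA')]
      have h2 : ∀ y, Q y (A ∩ (fun y => y v) ⁻¹' B) =
          (A ∩ (fun y => y v) ⁻¹' B).indicator 1 y := fun y => by
        rw [(hQ y).inter_eval_of_notMem hv' A hB, (hQ y).measure_eq_dirac hκ hd hA,
          Measure.dirac_apply' _ hA', inter_comm, ← indicator_indicator]
        rfl
      simp_rw [h1, h2]
      rw [lintegral_indicator_one (hA'.inter hB'), lintegral_indicator hA',
        h.inter_eval_of_mem v hvT A hA B hB]

end IsInterventionLaw

theorem exists_kernel_singleton [∀ v, IsMarkovKernel (κ v)] (hκ : IsNonanticipating κ) (v : V) :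
    ∃ Q : Kernel (∀ v, X v) (∀ v, X v), ∀ x, IsInterventionLaw κ {v} x (Q x) := by
  have hm : Measurable fun p : (∀ u, X u) × X v => Function.update p.1 v p.2 :=
    measurable_update'
  refine ⟨(Kernel.id ×ₖ κ v).map fun p => Function.update p.1 v p.2, fun x => ?_⟩
  have hQ : ((Kernel.id ×ₖ κ v).map fun p => Function.update p.1 v p.2) x =
      (κ v x).map (Function.update x v) := by
    rw [Kernel.map_apply _ hm, Kernel.prod_apply, Kernel.id_apply, Measure.dirac_prod,
      Measure.map_map hm measurable_prodMk_left]
    rfl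
  have hu : Measurable (Function.update x v) := measurable_update x
  rw [hQ]
  refine ⟨Measure.isProbabilityMeasure_map hu.aemeasurable, fun u hu' B hB => ?_,
    fun u hu' A hA B hB => ?_⟩
  · rw [Measure.map_apply hu (measurable_pi_apply u hB), ← preimage_comp]
    have : (fun y : ∀ u, X u => y u) ∘ Function.update x v = fun _ => x u :=
      funext fun a => Function.update_of_ne hu' _ _
    rw [this]
    by_cases hx : x u ∈ B <;> simp [hx]
  · obtain rfl : u = v := hu'
    have hA' : MeasurableSet A := cylinderEvents_le_pi _ hA
    have h0 : ∀ C : Set (∀ v, X v), MeasurableSet[cylinderEvents (Iio u)] C →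
        ∀ a, (Function.update x u a ∈ C ↔ x ∈ C) := by
      intro C hC a
      rw [cylinderEvents_eq_comap_domRestrict] at hC
      obtain ⟨C, -, rfl⟩ := hC
      have : (Iio u).domRestrict (Function.update x u a) = (Iio u).domRestrict x :=
        funext fun w => Function.update_of_ne (ne_of_lt w.2) _ _
      rw [mem_preimage, mem_preimage, this]
    -- The level set of `κ u · B` through `x` is an event before `u`, hence insensitive to the
    -- update.
    have h1 : ∀ a, κ u (Function.update x u a) B = κ u x B := fun a =>
      (h0 _ (hκ u B hB (measurableSet_singleton (κ u x B))) a).2 rfl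
    rw [Measure.map_apply hu (hA'.inter (measurable_pi_apply u hB)), ← lintegral_indicator hA',
      lintegral_map (((κ u).measurable_coe hB).indicator hA') hu]
    by_cases hx : x ∈ A
    · have h2 : Function.update x u ⁻¹' (A ∩ (fun y => y u) ⁻¹' B) = B := by
        ext a
        simp [h0 A hA, hx]
      have h3 : ∀ a, A.indicator (fun y => κ u y B) (Function.update x u a) = κ u x B := fun a => by
        rw [indicator_of_mem ((h0 A hA a).2 hx), h1]
      simp [h2, h3]
    · have h2 : Function.update x u ⁻¹' (A ∩ (fun y => y u) ⁻¹' B) = ∅ := by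
        ext a
        simp [h0 A hA, hx]
      have h3 : ∀ a, A.indicator (fun y => κ u y B) (Function.update x u a) = 0 := fun a =>
        indicator_of_notMem (fun h => hx ((h0 A hA a).1 h)) _
      simp [h2, h3]

end InterventionLaw

/-! ### Existence of intervention laws -/

/-- A time-inhomogeneous Markov chain with given transition kernels. -/
theorem exists_markovChain {Ω : Type*} [MeasurableSpace Ω] (q : ℕ → Kernel Ω Ω)
    [∀ n, IsMarkovKernel (q n)] :
    ∃ P : Kernel Ω (ℕ → Ω), IsMarkovKernel P ∧
      (∀ x, (P x).map (fun ω => ω 0) = Measure.dirac x) ∧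
      ∀ x n, (P x).map (fun ω => (ω n, ω (n + 1))) = ((P x).map fun ω => ω n) ⊗ₘ q n := by
  let κ : (n : ℕ) → Kernel (∀ _ : Finset.Iic n, Ω) Ω := fun n =>
    (q n).comap (fun y => y ⟨n, Finset.mem_Iic.2 le_rfl⟩) (measurable_pi_apply _)
  have hc : Measurable fun (x : Ω) (_ : Finset.Iic 0) => x := by fun_prop
  refine ⟨(Kernel.traj (X := fun _ => Ω) κ 0).comap _ hc, inferInstance, fun x => ?_, fun x n => ?_⟩
  · rw [Kernel.comap_apply]
    have h1 : (fun ω : ℕ → Ω => ω 0) =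
      (fun y => y ⟨0, Finset.mem_Iic.2 le_rfl⟩) ∘ Preorder.frestrictLe (π := fun _ => Ω) 0 := rfl
    rw [h1, ← Measure.map_map (measurable_pi_apply _) (by fun_prop),
      Kernel.traj_map_frestrictLe_apply, Kernel.partialTraj_self, Kernel.id_apply,
      Measure.map_dirac' (measurable_pi_apply _)]
  · rw [Kernel.comap_apply]
    have h1 : (fun ω : ℕ → Ω => (ω n, ω (n + 1))) =
      Prod.map (fun y => y ⟨n, Finset.mem_Iic.2 le_rfl⟩) id ∘
        fun ω => (Preorder.frestrictLe (π := fun _ => Ω) n ω, ω (n + 1)) := rfl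
    have h2 : (fun ω : ℕ → Ω => ω n) =
      (fun y => y ⟨n, Finset.mem_Iic.2 le_rfl⟩) ∘ Preorder.frestrictLe (π := fun _ => Ω) n := rfl
    rw [h1, h2, ← Measure.map_map (by fun_prop) (by fun_prop),
      ← Measure.map_map (by fun_prop) (by fun_prop), ← Kernel.partialTraj_compProd_eq_map_traj zero_le,
      Kernel.traj_map_frestrictLe_apply]
    ext s hs
    rw [Measure.map_apply (by fun_prop) hs, Measure.compProd_apply (hs.preimage (by fun_prop)),
      Measure.compProd_apply hs, lintegral_map (Kernel.measurable_kernel_prodMk_left hs)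
        (measurable_pi_apply _)]
    rfl

section Existence

open Set

variable {V : Type*} [LinearOrder V] {X : V → Type*} [∀ v, MeasurableSpace (X v)]
  {κ : ∀ v, Kernel (∀ u, X u) (X v)} {T : Set V} {x : ∀ v, X v} {ν : Measure (∀ v, X v)}

/-- Being an intervention law for `T` is inherited along agreement on the cylinder events on sets
of coordinates that cover `V`. -/
theorem isInterventionLaw_of_forall_eq [IsProbabilityMeasure ν] (hκ : IsNonanticipating κ)
    (h : ∀ v, ∃ T' ν' D, IsInterventionLaw κ T' x ν' ∧ (v ∈ T ↔ v ∈ T') ∧ v ∈ D ∧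
      (v ∈ T → Iio v ⊆ D) ∧ ∀ A, MeasurableSet[cylinderEvents D] A → ν A = ν' A) :
    IsInterventionLaw κ T x ν := by
  refine ⟨inferInstance, fun v hv B hB => ?_, fun v hv A hA B hB => ?_⟩
  · obtain ⟨T', ν', D, h', hT, hvD, -, heq⟩ := h v
    rw [heq _ (measurableSet_cylinderEvents_eval hvD hB),
      h'.eval_of_notMem v (fun hc => hv (hT.2 hc)) B hB]
  · obtain ⟨T', ν', D, h', hT, hvD, hD, heq⟩ := h v
    have hle := cylinderEvents_mono (X := X) (hD hv)
    rw [heq _ ((hle _ hA).inter (measurableSet_cylinderEvents_eval hvD hB)),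
      h'.inter_eval_of_mem v (hT.1 hv) A hA B hB]
    exact (setLIntegral_eq_of_forall_measurableSet cylinderEvents_le_pi
      (fun C hC => heq C (hle C hC)) (hκ v B hB) hA).symm

/-- Step `n` of a Markov chain on the whole product redraws the block `S (n + 1) \ S n`. Each
coordinate is redrawn at most once, so the limit is read off coordinatewise, without topology. -/
theorem exists_kernel_iUnion [WellFoundedLT V] (hκ : IsNonanticipating κ) {S : ℕ → Set V}
    (hS₀ : S 0 = ∅) (hS : Monotone S) (hlt : ∀ n, ∀ s ∈ S n, ∀ t ∈ S (n + 1) \ S n, s < t)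
    (hQ : ∀ n, ∃ Q : Kernel (∀ v, X v) (∀ v, X v),
      ∀ x, IsInterventionLaw κ (S (n + 1) \ S n) x (Q x)) :
    ∃ Q : Kernel (∀ v, X v) (∀ v, X v), ∀ x, IsInterventionLaw κ (⋃ n, S n) x (Q x) := by
  choose q hq using hQ
  have : ∀ n, IsMarkovKernel (q n) := fun n => ⟨fun x => (hq n x).isProbabilityMeasure⟩
  obtain ⟨P, hP, hP₀, hP'⟩ := exists_markovChain q
  have hlaw : ∀ n x, IsInterventionLaw κ (S n) x ((P x).map fun ω => ω n) := by
    intro n x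
    induction n with
    | zero =>
      rw [hP₀, hS₀]
      exact IsInterventionLaw.dirac κ x
    | succ n ih =>
      have h1 : ((P x).map fun ω => ω (n + 1)) = ((P x).map fun ω => ω n).bind (q n) := by
        have := ih.isProbabilityMeasure
        rw [← Measure.snd_compProd, ← hP', Measure.snd, Measure.map_map (by fun_prop) (by fun_prop)]
        rfl
      rw [h1, ← union_sdiff_cancel (hS (Nat.le_succ n))]
      exact ih.bind hκ (hq n) (hlt n)
  -- Equality of two coordinates need not be a measurable event, so constancy is tested one event
  -- `B` at a time.
  have hstep : ∀ x n v, v ∉ S (n + 1) \ S n → ∀ B : Set (X v), MeasurableSet B →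
      ∀ᵐ ω ∂P x, (ω n v ∈ B ↔ ω (n + 1) v ∈ B) := by
    intro x n v hv B hB
    have hm : MeasurableSet {p : (∀ v, X v) × (∀ v, X v) | p.1 v ∈ B ↔ p.2 v ∈ B} := by
      have h1 : MeasurableSet {p : (∀ v, X v) × (∀ v, X v) | p.1 v ∈ B} :=
        hB.preimage (by fun_prop : Measurable fun p : (∀ v, X v) × (∀ v, X v) => p.1 v)
      have h2 : MeasurableSet {p : (∀ v, X v) × (∀ v, X v) | p.2 v ∈ B} :=
        hB.preimage (by fun_prop : Measurable fun p : (∀ v, X v) × (∀ v, X v) => p.2 v)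
      exact h1.iff h2
    have h1 : ∀ᵐ p ∂(((P x).map fun ω => ω n) ⊗ₘ q n), (p.1 v ∈ B ↔ p.2 v ∈ B) := by
      refine Measure.ae_compProd_of_ae_ae hm (.of_forall fun y => ?_)
      by_cases hy : y v ∈ B
      · have := (hq n y).eval_of_notMem v hv Bᶜ hB.compl
        rw [indicator_of_notMem (by simpa using hy)] at this
        simp only [hy, true_iff, ae_iff]
        exact this
      · have := (hq n y).eval_of_notMem v hv B hB
        rw [indicator_of_notMem hy] at this
        simp only [hy, false_iff, ae_iff, not_not]
        exact this
    rw [← hP'] at h1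
    exact ae_of_ae_map (by fun_prop) h1
  -- The first stage containing `v`; the default `sInf ∅ = 0` gives a coordinate that is never
  -- redrawn its initial value.
  let idx : V → ℕ := fun v => sInf {n | v ∈ S n}
  let L : (ℕ → ∀ v, X v) → ∀ v, X v := fun ω v => ω (idx v) v
  have hL : Measurable L := measurable_pi_lambda _ fun v => by fun_prop
  have heval : ∀ x m, ∀ v ∈ S m ∪ (⋃ n, S n)ᶜ, ∀ B : Set (X v), MeasurableSet B →
      ∀ᵐ ω ∂P x, (L ω v ∈ B ↔ ω m v ∈ B) := by
    intro x m v hv B hB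
    have hm : idx v ≤ m := by
      rcases hv with hv | hv
      · exact Nat.sInf_le hv
      · have : {n | v ∈ S n} = ∅ := eq_empty_of_forall_notMem fun n hn => hv (mem_iUnion.2 ⟨n, hn⟩)
        simp [idx, this]
    have hS' : ∀ n, idx v ≤ n → v ∉ S (n + 1) \ S n := by
      rintro n hn ⟨h1, h2⟩
      exact h2 (hS hn (Nat.sInf_mem (s := {n | v ∈ S n}) ⟨_, h1⟩))
    induction m, hm using Nat.le_induction with
    | base => exact .of_forall fun _ => Iff.rfl
    | succ n hn ih =>
      have hvn : v ∈ S n ∪ (⋃ n, S n)ᶜ := by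
        by_cases h : v ∈ ⋃ n, S n
        · obtain ⟨k, hk⟩ := mem_iUnion.1 h
          exact Or.inl (hS hn (Nat.sInf_mem (s := {n | v ∈ S n}) ⟨k, hk⟩))
        · exact Or.inr h
      filter_upwards [ih hvn, hstep x n v (hS' n hn) B hB] with ω h1 h2 using h1.trans h2
  refine ⟨P.map L, fun x => ?_⟩
  rw [Kernel.map_apply _ hL]
  have : IsProbabilityMeasure ((P x).map L) := Measure.isProbabilityMeasure_map hL.aemeasurable
  refine isInterventionLaw_of_forall_eq hκ fun v => ?_
  obtain ⟨m, hm⟩ : ∃ m, v ∈ S m ∪ (⋃ n, S n)ᶜ := by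
    by_cases h : v ∈ ⋃ n, S n
    · obtain ⟨k, hk⟩ := mem_iUnion.1 h
      exact ⟨k, Or.inl hk⟩
    · exact ⟨0, Or.inr h⟩
  refine ⟨S m, _, _, hlaw m x, ⟨fun hv => hm.resolve_right (not_not_intro hv),
    fun hv => mem_iUnion.2 ⟨m, hv⟩⟩, hm, fun hv u hu => ?_, fun A hA => ?_⟩
  -- A predecessor `u` of `v` that joins only after stage `m` would lie above all of `S m`, hence
  -- above `v`.
  · by_contra huS
    simp only [mem_union, not_or, notMem_compl_iff] at huS
    obtain ⟨k, hk⟩ := mem_iUnion.1 huS.2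
    have hmk : m ≤ k := (le_total m k).resolve_right fun h => huS.1 (hS h hk)
    have hvm : v ∈ S m := hm.resolve_right (not_not_intro hv)
    clear hv
    induction k, hmk using Nat.le_induction with
    | base => exact huS.1 hk
    | succ n hn ih =>
      by_cases hun : u ∈ S n
      · exact ih hun
      · exact lt_asymm (mem_Iio.1 hu) (hlt n v (hS hn hvm) u ⟨hk, hun⟩)
  · have hA' : MeasurableSet A := cylinderEvents_le_pi _ hA
    rw [Measure.map_apply hL hA', Measure.map_apply (by fun_prop) hA']
    exact measure_preimage_eq_of_forall_eval (heval x m) hA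

/-- Every event of a product space is determined by the coordinates outside `T` and the coordinates
below the terms of some sequence in `T`. -/
theorem exists_measurableSet_cylinderEvents_of_nonempty (hT : T.Nonempty) {A : Set (∀ v, X v)}
    (hA : MeasurableSet A) :
    ∃ j : ℕ → T, MeasurableSet[cylinderEvents {v | v ∈ T → ∃ i, v ≤ j i}] A := by
  have hA' : MeasurableSet[cylinderEvents univ] A := by rwa [cylinderEvents_univ]
  obtain ⟨t₀, ht₀⟩ := hT
  refine cylinderEvents_induction (p := fun A => ∃ j : ℕ → T,
    MeasurableSet[cylinderEvents {v | v ∈ T → ∃ i, v ≤ j i}] A) (fun v _ B hB => ?_)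
    ⟨fun _ => ⟨t₀, ht₀⟩, @MeasurableSet.empty _ (_)⟩ ?_ ?_ hA'
  · by_cases hv : v ∈ T
    · exact ⟨fun _ => ⟨v, hv⟩, measurableSet_cylinderEvents_eval (fun _ => ⟨0, le_rfl⟩) hB⟩
    · exact ⟨fun _ => ⟨t₀, ht₀⟩, measurableSet_cylinderEvents_eval
        (show v ∈ {v | v ∈ T → _} from fun h => absurd h hv) hB⟩
  · rintro A - ⟨j, hj⟩
    exact ⟨j, hj.compl⟩
  · rintro f - hf
    choose j hj using hf
    refine ⟨fun n => j n.unpair.1 n.unpair.2, MeasurableSet.iUnion fun n => ?_⟩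
    refine cylinderEvents_mono (fun v hv hvT => ?_) _ (hj n)
    obtain ⟨i, hi⟩ := hv hvT
    exact ⟨Nat.pair n i, by simpa using hi⟩

/-- An event is measured by the law of any sequence that determines it; the choice is immaterial
because two sequences have a common bound. -/
theorem exists_kernel_of_forall_sequence [WellFoundedLT V] (hκ : IsNonanticipating κ)
    (hT : T.Nonempty) (h : ∀ j : ℕ → T, ∃ Q : Kernel (∀ v, X v) (∀ v, X v),
      ∀ x, IsInterventionLaw κ {v | v ∈ T ∧ ∃ i, v ≤ j i} x (Q x)) :
    ∃ Q : Kernel (∀ v, X v) (∀ v, X v), ∀ x, IsInterventionLaw κ T x (Q x) := by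
  choose N hN using h
  have : Nonempty T := hT.to_subtype
  choose! J hJ using fun (A : Set (∀ v, X v)) (hA : MeasurableSet A) =>
    exists_measurableSet_cylinderEvents_of_nonempty hT hA
  have hmono : ∀ (j k : ℕ → T), (∀ i, ∃ i', j i ≤ k i') → ∀ x A,
      MeasurableSet[cylinderEvents {v | v ∈ T → ∃ i, v ≤ j i}] A → N k x A = N j x A := by
    intro j k hjk x A hA
    refine (hN k x).measure_eq hκ (hN j x) (D := {v | v ∈ T → ∃ i, v ≤ j i}) (fun v hv => ?_)
      (fun v hv hv' u hu _ => ?_) hA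
    · refine ⟨fun h => ⟨h.1, hv h.1⟩, fun ⟨h, i, hi⟩ => ⟨h, ?_⟩⟩
      obtain ⟨i', hi'⟩ := hjk i
      exact ⟨i', hi.trans hi'⟩
    · obtain ⟨i, hi⟩ := hv hv'.1
      exact ⟨i, (le_of_lt hu).trans hi⟩
  have heq : ∀ (j k : ℕ → T) x A, MeasurableSet[cylinderEvents {v | v ∈ T → ∃ i, v ≤ j i}] A →
      MeasurableSet[cylinderEvents {v | v ∈ T → ∃ i, v ≤ k i}] A → N j x A = N k x A := by
    intro j k x A hj hk
    let l : ℕ → T := fun n => if n.unpair.1 = 0 then j n.unpair.2 else k n.unpair.2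
    rw [← hmono j l (fun i => ⟨Nat.pair 0 i, by simp [l]⟩) x A hj,
      ← hmono k l (fun i => ⟨Nat.pair 1 i, by simp [l]⟩) x A hk]
  let μ : (∀ v, X v) → Measure (∀ v, X v) := fun x =>
    Measure.ofMeasurable (fun A _ => N (J A) x A) measure_empty fun f hf hd => by
      -- One sequence merging those of all `f n` reduces countable additivity to that of the single
      -- measure `N j x`.
      let j : ℕ → T := fun n => J (f n.unpair.1) n.unpair.2
      have hj : ∀ n, MeasurableSet[cylinderEvents {v | v ∈ T → ∃ i, v ≤ j i}] (f n) := fun n => by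
        refine cylinderEvents_mono (fun v hv hvT => ?_) _ (hJ (f n) (hf n))
        obtain ⟨i, hi⟩ := hv hvT
        exact ⟨Nat.pair n i, by simpa [j] using hi⟩
      rw [heq _ j x _ (hJ _ (MeasurableSet.iUnion hf)) (MeasurableSet.iUnion hj),
        measure_iUnion hd hf]
      exact tsum_congr fun n => heq _ _ x _ (hj n) (hJ _ (hf n))
  have hμ : ∀ x A, MeasurableSet A → μ x A = N (J A) x A := fun x A hA =>
    Measure.ofMeasurable_apply A hA
  have hμm : Measurable μ := Measure.measurable_of_measurable_coe _ fun A hA => by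
    simp_rw [fun x => hμ x A hA]
    exact (N (J A)).measurable_coe hA
  refine ⟨⟨μ, hμm⟩, fun x => ?_⟩
  change IsInterventionLaw κ T x (μ x)
  have : IsProbabilityMeasure (μ x) := by
    refine ⟨?_⟩
    have := (hN (J univ) x).isProbabilityMeasure
    rw [hμ x _ MeasurableSet.univ, measure_univ]
  refine isInterventionLaw_of_forall_eq hκ fun v => ?_
  obtain ⟨t₀, ht₀⟩ := hT
  obtain ⟨j, hj⟩ : ∃ j : ℕ → T, v ∈ T → ∃ i, v ≤ j i := by
    by_cases hv : v ∈ T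
    · exact ⟨fun _ => ⟨v, hv⟩, fun _ => ⟨0, le_rfl⟩⟩
    · exact ⟨fun _ => ⟨t₀, ht₀⟩, fun h => absurd h hv⟩
  refine ⟨_, _, {v | v ∈ T → ∃ i, v ≤ j i}, hN j x, ⟨fun hv => ⟨hv, hj hv⟩, And.left⟩, hj,
    fun hv u hu _ => ?_, fun A hA => ?_⟩
  · obtain ⟨i, hi⟩ := hj hv
    exact ⟨i, (le_of_lt hu).trans hi⟩
  · have hA' : MeasurableSet A := cylinderEvents_le_pi _ hA
    rw [hμ x A hA', heq _ j x A (hJ A hA') hA]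

/-- Along a sequence `j`, block `n` consists of the members of `T` up to `j n` that exceed all
earlier terms. It is bounded by a member of `T` and lies after the previous blocks, though it may be
empty. -/
theorem exists_kernel_of_forall_subset_Iic [WellFoundedLT V] (hκ : IsNonanticipating κ)
    (h : ∀ t ∈ T, ∀ S ⊆ T ∩ Iic t, ∃ Q : Kernel (∀ v, X v) (∀ v, X v),
      ∀ x, IsInterventionLaw κ S x (Q x)) :
    ∃ Q : Kernel (∀ v, X v) (∀ v, X v), ∀ x, IsInterventionLaw κ T x (Q x) := by
  rcases T.eq_empty_or_nonempty with rfl | hT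
  · exact ⟨Kernel.id, fun x => by rw [Kernel.id_apply]; exact IsInterventionLaw.dirac κ x⟩
  refine exists_kernel_of_forall_sequence hκ hT fun j => ?_
  have hU : {v | v ∈ T ∧ ∃ i, v ≤ j i} = ⋃ n, {v | v ∈ T ∧ ∃ i < n, v ≤ j i} := by
    ext v
    simp only [mem_ofPred_eq, mem_iUnion]
    exact ⟨fun ⟨hv, i, hi⟩ => ⟨i + 1, hv, i, i.lt_succ_self, hi⟩,
      fun ⟨_, hv, i, _, hi⟩ => ⟨hv, i, hi⟩⟩
  have hnew : ∀ n, ∀ t ∈ {v | v ∈ T ∧ ∃ i < n + 1, v ≤ j i} \ {v | v ∈ T ∧ ∃ i < n, v ≤ j i},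
      t ∈ T ∧ t ≤ j n ∧ ∀ i < n, j i < t := by
    rintro n t ⟨⟨ht, i, hi, hti⟩, hn⟩
    have hlt : ∀ i < n, j i < t := fun i hi => lt_of_not_ge fun hc => hn ⟨ht, i, hi, hc⟩
    rcases (Nat.lt_succ_iff_lt_or_eq.1 hi) with hi' | rfl
    · exact absurd hti (not_le_of_gt (hlt i hi'))
    · exact ⟨ht, hti, hlt⟩
  rw [hU]
  refine exists_kernel_iUnion hκ (by simp) ?_ ?_ fun n => ?_
  · exact fun m n hmn v ⟨hv, i, hi, hvi⟩ => ⟨hv, i, hi.trans_le hmn, hvi⟩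
  · rintro n s ⟨-, i, hi, hsi⟩ t ht
    exact hsi.trans_lt ((hnew n t ht).2.2 i hi)
  · exact h (j n) (j n).2 _ fun t ht => ⟨(hnew n t ht).1, (hnew n t ht).2.1⟩

/-- A transfinite version of the Ionescu-Tulcea theorem. -/
theorem exists_kernel_isInterventionLaw [WellFoundedLT V] [∀ v, IsMarkovKernel (κ v)]
    (hκ : IsNonanticipating κ) (T : Set V) :
    ∃ Q : Kernel (∀ v, X v) (∀ v, X v), ∀ x, IsInterventionLaw κ T x (Q x) := by
  -- All subsets of `Iic v` are included because the blocks are differences of initial segments.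
  have key : ∀ v, ∀ S ⊆ Iic v, ∃ Q : Kernel (∀ v, X v) (∀ v, X v),
      ∀ x, IsInterventionLaw κ S x (Q x) := by
    intro v
    induction v using WellFoundedLT.induction with
    | ind v ih =>
      intro S hS
      obtain ⟨Q, hQ⟩ := exists_kernel_of_forall_subset_Iic (T := S ∩ Iio v) hκ
        fun t ht R hR => ih t ht.2 R (hR.trans inter_subset_right)
      by_cases hv : v ∈ S
      · obtain ⟨R, hR⟩ := exists_kernel_singleton hκ v
        refine ⟨R ∘ₖ Q, fun x => ?_⟩
        have hSv : S = S ∩ Iio v ∪ {v} := by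
          ext u
          simp only [mem_union, mem_inter_iff, mem_Iio, mem_singleton_iff]
          refine ⟨fun hu => ?_, ?_⟩
          · rcases eq_or_lt_of_le (show u ≤ v from hS hu) with rfl | h
            exacts [Or.inr rfl, Or.inl ⟨hu, h⟩]
          · rintro (h | rfl)
            exacts [h.1, hv]
        rw [Kernel.comp_apply, hSv]
        refine (hQ x).bind hκ hR fun s hs t ht => ?_
        rw [mem_singleton_iff.1 ht]
        exact hs.2
      · have hSv : S ∩ Iio v = S := inter_eq_left.2 fun u hu =>
          lt_of_le_of_ne (hS hu) fun h => hv (h ▸ hu)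
        rw [hSv] at hQ
        exact ⟨Q, hQ⟩
  exact exists_kernel_of_forall_subset_Iic hκ fun t _ S hS => key t S (hS.trans inter_subset_right)

end Existence

/-! ### Kernel identities and conditional expectations -/

section ConditionalProbability

open Set

variable {Ω : Type*} {m m' m₀ : MeasurableSpace Ω} {μ : Measure Ω} [IsProbabilityMeasure μ]
  {E : Set Ω} {k : Ω → ENNReal}

theorem integrable_toReal_of_le_one (hk : Measurable k) (hk₁ : ∀ x, k x ≤ 1) :
    Integrable (fun x => (k x).toReal) μ := by
  refine integrable_toReal_of_lintegral_ne_top hk.aemeasurable (ne_top_of_le_ne_top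
    (ENNReal.one_ne_top) ((lintegral_mono hk₁).trans ?_))
  simp

theorem toReal_ae_eq_condExp_indicator (hm : m ≤ m₀) (hE : MeasurableSet E)
    (hk : Measurable[m] k) (hk₁ : ∀ x, k x ≤ 1)
    (h : ∀ A, MeasurableSet[m] A → μ (A ∩ E) = ∫⁻ x in A, k x ∂μ) :
    (fun x => (k x).toReal) =ᵐ[μ] μ⟦E|m⟧ := by
  have hi : Integrable (fun x => (k x).toReal) μ :=
    integrable_toReal_of_le_one (hk.mono hm le_rfl) hk₁
  refine ae_eq_condExp_of_forall_setIntegral_eq hm ((integrable_const 1).indicator hE)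
    (fun _ _ _ => hi.integrableOn) (fun A hA _ => ?_)
    hk.ennreal_toReal.stronglyMeasurable.aestronglyMeasurable
  rw [integral_toReal (hk.mono hm le_rfl).aemeasurable
    (.of_forall fun x => (hk₁ x).trans_lt ENNReal.one_lt_top), ← h A hA,
    setIntegral_indicator hE]
  simp [measureReal_def]

/-- The conditional probability of `E` given the larger `m'` is `k`, which is already
`m`-measurable; the tower property then pulls it out. -/
theorem condExp_indicator_inter_ae_eq_mul (hm : m ≤ m') (hm' : m' ≤ m₀) (hE : MeasurableSet E)
    (hk : Measurable[m] k) (hk₁ : ∀ x, k x ≤ 1)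
    (h : ∀ A, MeasurableSet[m'] A → μ (A ∩ E) = ∫⁻ x in A, k x ∂μ) {B : Set Ω}
    (hB : MeasurableSet[m'] B) : μ⟦E ∩ B|m⟧ =ᵐ[μ] μ⟦E|m⟧ * μ⟦B|m⟧ := by
  have hi : Integrable (fun x => (k x).toReal) μ :=
    integrable_toReal_of_le_one (hk.mono (hm.trans hm') le_rfl) hk₁
  have hiE : Integrable (E.indicator fun _ => (1 : ℝ)) μ := (integrable_const 1).indicator hE
  have hiB : Integrable (B.indicator fun _ => (1 : ℝ)) μ :=
    (integrable_const 1).indicator (hm' _ hB)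
  have h1 := toReal_ae_eq_condExp_indicator hm' hE (hk.mono hm le_rfl) hk₁ h
  have h2 := toReal_ae_eq_condExp_indicator (hm.trans hm') hE hk hk₁ fun A hA => h A (hm _ hA)
  have h3 : μ⟦E ∩ B|m'⟧ =ᵐ[μ] (fun x => (k x).toReal) * B.indicator fun _ => (1 : ℝ) := by
    have : (E ∩ B).indicator (fun _ => (1 : ℝ)) = B.indicator (E.indicator fun _ => 1) := by
      rw [indicator_indicator, inter_comm]
    rw [this]
    refine (condExp_indicator hiE hB).trans ?_
    filter_upwards [h1] with x hx
    by_cases hxB : x ∈ B <;> simp [hxB, hx]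
  have h4 : Integrable ((fun x => (k x).toReal) * B.indicator fun _ => (1 : ℝ)) μ := by
    have : (fun x => (k x).toReal) * B.indicator (fun _ => (1 : ℝ)) =
        B.indicator fun x => (k x).toReal := by
      ext x
      by_cases hxB : x ∈ B <;> simp [hxB]
    rw [this]
    exact hi.indicator (hm' _ hB)
  calc μ⟦E ∩ B|m⟧ =ᵐ[μ] μ[μ⟦E ∩ B|m'⟧|m] := (condExp_condExp_of_le hm hm').symm
    _ =ᵐ[μ] μ[(fun x => (k x).toReal) * B.indicator fun _ => (1 : ℝ)|m] := condExp_congr_ae h3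
    _ =ᵐ[μ] (fun x => (k x).toReal) * μ⟦B|m⟧ :=
      condExp_mul_of_stronglyMeasurable_left hk.ennreal_toReal.stronglyMeasurable h4 hiB
    _ =ᵐ[μ] μ⟦E|m⟧ * μ⟦B|m⟧ := h2.mul .rfl

/-- Absorbing `k` into the conditional expectation of the indicator of `A` and integrating removes
the conditioning. -/
theorem measure_inter_eq_setLIntegral_of_condExp (hm : m ≤ m₀) (hE : MeasurableSet E)
    (hk : Measurable[m] k) (hk₁ : ∀ x, k x ≤ 1) (hkE : (fun x => (k x).toReal) =ᵐ[μ] μ⟦E|m⟧)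
    {A : Set Ω} (hA : MeasurableSet A) (h : μ⟦E ∩ A|m⟧ =ᵐ[μ] μ⟦E|m⟧ * μ⟦A|m⟧) :
    μ (A ∩ E) = ∫⁻ x in A, k x ∂μ := by
  have hi : Integrable (fun x => (k x).toReal) μ :=
    integrable_toReal_of_le_one (hk.mono hm le_rfl) hk₁
  have hiA : Integrable (A.indicator fun _ => (1 : ℝ)) μ := (integrable_const 1).indicator hA
  have h1 : (fun x => (k x).toReal) * A.indicator (fun _ => (1 : ℝ)) =
      A.indicator fun x => (k x).toReal := by
    ext x
    by_cases hxA : x ∈ A <;> simp [hxA]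
  have h2 : μ⟦E ∩ A|m⟧ =ᵐ[μ] μ[A.indicator fun x => (k x).toReal|m] := by
    refine h.trans ((hkE.symm.mul .rfl).trans ?_)
    rw [← h1]
    refine (condExp_mul_of_stronglyMeasurable_left hk.ennreal_toReal.stronglyMeasurable ?_ hiA).symm
    rw [h1]
    exact hi.indicator hA
  have h3 := integral_congr_ae h2
  rw [integral_condExp hm, integral_condExp hm, integral_indicator (hE.inter hA),
    integral_indicator hA, integral_toReal (hk.mono hm le_rfl).aemeasurable
    (.of_forall fun x => (hk₁ x).trans_lt ENNReal.one_lt_top), setIntegral_const, smul_eq_mul,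
    mul_one, measureReal_def, inter_comm] at h3
  refine (ENNReal.toReal_eq_toReal_iff' (measure_ne_top _ _) ?_).1 h3
  refine ne_top_of_le_ne_top ENNReal.one_ne_top ((lintegral_mono hk₁).trans ?_)
  simpa using prob_le_one

end ConditionalProbability

/-! ### Conditioning on later coordinates -/

section NonDescendants

open Set

variable {V : Type*} [LinearOrder V] {X : V → Type*} [∀ v, MeasurableSpace (X v)]
  {κ : ∀ v, Kernel (∀ u, X u) (X v)} {x : ∀ v, X v} {ν : Measure (∀ v, X v)}

/-- Each coordinate is drawn from its kernel even when all coordinates in a set `D` are known,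
provided that `D` contains the coordinates on which the kernels of its members depend. -/
theorem IsInterventionLaw.inter_eval_of_forall_measurable [WellFoundedLT V]
    [∀ v, IsMarkovKernel (κ v)] (hκ : IsNonanticipating κ) (h : IsInterventionLaw κ univ x ν)
    {v : V} {D : Set V} (hvD : v ∉ D) (hD : ∀ w ∈ D, ∀ B : Set (X w), MeasurableSet B →
      Measurable[cylinderEvents (D ∩ Iio w)] fun x => κ w x B)
    {A : Set (∀ v, X v)} (hA : MeasurableSet[cylinderEvents D] A) {B : Set (X v)}
    (hB : MeasurableSet B) : ν (A ∩ (fun y => y v) ⁻¹' B) = ∫⁻ y in A, κ v y B ∂ν := by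
  have := h.isProbabilityMeasure
  have hm : ∀ w, ∀ B : Set (X w), MeasurableSet B → Measurable fun y => κ w y B :=
    fun w B hB => (κ w).measurable_coe hB
  have hE : MeasurableSet ((fun y : ∀ u, X u => y v) ⁻¹' B) := measurable_pi_apply v hB
  -- Both sides are finite measures in `A`, so agreement can be proved by induction along `D`.
  suffices ν.restrict ((fun y => y v) ⁻¹' B) A = ν.withDensity (fun y => κ v y B) A by
    rwa [Measure.restrict_apply (cylinderEvents_le_pi _ hA),
      withDensity_apply _ (cylinderEvents_le_pi _ hA)] at this
  refine measure_eq_of_forall_inter_eval ?_ (fun w hw ih A hA B' hB' => ?_) hA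
  · rw [withDensity_apply _ MeasurableSet.univ,
      ← h.inter_eval_of_mem v (mem_univ v) univ MeasurableSet.univ B hB]
    simp
  · have hA' : MeasurableSet A := cylinderEvents_le_pi _ hA
    have hW : MeasurableSet ((fun y : ∀ u, X u => y w) ⁻¹' B') := measurable_pi_apply w hB'
    have hAw : MeasurableSet[cylinderEvents (Iio w)] A :=
      cylinderEvents_mono inter_subset_right _ hA
    rw [Measure.restrict_apply (hA'.inter hW), withDensity_apply _ (hA'.inter hW)]
    rcases lt_trichotomy w v with hwv | rfl | hvw
    · exact h.inter_eval_of_mem v (mem_univ v) _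
        ((cylinderEvents_mono (Iio_subset_Iio hwv.le) _ hAw).inter
          (measurableSet_cylinderEvents_eval (show w ∈ Iio v from hwv) hB')) B hB
    · exact absurd hw hvD
    -- For `w` after `v`, both sides equal the integral over `A` of the product of the two kernel
    -- values. `h1` draws `w` after `v` and uses the inductive hypothesis, as the kernel of `w`
    -- depends only on `D` before `w`; `h2` draws `w` against the integrand `κ v y B`.
    · have h1 : ∫⁻ y in A, κ w y B' ∂(ν.restrict ((fun y => y v) ⁻¹' B)) =
          ∫⁻ y in A, κ w y B' ∂(ν.withDensity fun y => κ v y B) :=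
        setLIntegral_eq_of_forall_measurableSet cylinderEvents_le_pi ih (hD w hw B' hB') hA
      have h2 : ∫⁻ y, A.indicator (fun y => κ v y B) y ∂(ν.restrict ((fun y => y w) ⁻¹' B')) =
          ∫⁻ y, A.indicator (fun y => κ v y B) y ∂(ν.withDensity fun y => κ w y B') := by
        refine lintegral_eq_of_forall_measurableSet
          (cylinderEvents_le_pi (X := X) (Δ := Iio w)) (fun C hC => ?_) ?_
        · rw [Measure.restrict_apply (cylinderEvents_le_pi _ hC),
            withDensity_apply _ (cylinderEvents_le_pi _ hC)]
          exact h.inter_eval_of_mem w (mem_univ w) C hC B' hB'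
        · exact ((hκ v B hB).mono (cylinderEvents_mono (Iio_subset_Iio hvw.le)) le_rfl).indicator hAw
      rw [Measure.restrict_restrict hA', setLIntegral_withDensity_eq_setLIntegral_mul _ (hm v B hB)
        (hm w B' hB') hA', h.inter_eval_of_mem w (mem_univ w) _ (hAw.inter
          (measurableSet_cylinderEvents_eval (show v ∈ Iio w from hvw) hB)) B' hB' |>.symm] at h1
      rw [lintegral_indicator hA', Measure.restrict_restrict hA',
        lintegral_withDensity_eq_lintegral_mul _ (hm w B' hB') ((hm v B hB).indicator hA')] at h2
      rw [inter_right_comm, h1, h2, ← lintegral_indicator hA']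
      refine lintegral_congr fun y => ?_
      by_cases hy : y ∈ A <;> simp [hy, mul_comm]

end NonDescendants

theorem Digraph.WellFoundedDigraph.wellFounded_adj {V : Type*} {G : Digraph V}
    (h : G.WellFoundedDigraph) : WellFounded G.Adj :=
  wellFounded_iff_isEmpty_descending_chain.2 ⟨fun s => h ⟨s.1, s.2⟩⟩

/-! ### Bayesian networks as intervention laws -/

namespace MTBN

open Set

variable {V : Type*} {X : V → Type*} [∀ v, MeasurableSpace (X v)]

/-- The kernel of a vertex, as a kernel from the product of all spaces. -/
noncomputable def piKernel (M : MTBN V X) (v : V) : Kernel (∀ u, X u) (X v) :=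
  (M.kernel v).comap (M.graph.parents v).domRestrict (by fun_prop)

instance (M : MTBN V X) (v : V) : IsMarkovKernel (M.piKernel v) :=
  have := M.isMarkovKernel v
  inferInstanceAs (IsMarkovKernel ((M.kernel v).comap _ _))

theorem measurable_piKernel (M : MTBN V X) (v : V) {B : Set (X v)} (hB : MeasurableSet B) :
    Measurable[cylinderEvents (M.graph.parents v)] fun x => M.piKernel v x B := by
  rw [cylinderEvents_eq_comap_domRestrict]
  exact ((M.kernel v).measurable_coe hB).comp (comap_measurable _)

/-- A point of the parents' product yields a probability measure on `X v`, which forces a point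
there. This supplies the base point that intervention laws require. -/
theorem nonempty_of_wellFounded (M : MTBN V X) (v : V) : Nonempty (X v) := by
  induction v using M.wellFounded.wellFounded_adj.induction with
  | h v ih =>
    have : ∀ u : M.graph.parents v, Nonempty (X u) := fun u => ih u u.2
    have := (M.isMarkovKernel v).isProbabilityMeasure (fun u => (this u).some)
    exact (M.kernel v fun u => (‹∀ u : M.graph.parents v, Nonempty (X u)› u).some).nonempty_of_neZero

theorem represents_iff_isInterventionLaw [LinearOrder V] [WellFoundedLT V] (M : MTBN V X)
    (hM : ∀ u v, M.graph.Adj u v → u < v) (x : ∀ v, X v) {μ : Measure (∀ v, X v)}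
    [IsProbabilityMeasure μ] :
    M.Represents μ ↔ IsInterventionLaw M.piKernel univ x μ := by
  have hpa : ∀ v, M.graph.parents v ⊆ Iio v := fun v u hu => hM u v hu
  have hle : ∀ u v, Relation.ReflTransGen M.graph.Adj u v → u ≤ v := fun u v h => by
    induction h with
    | refl => exact le_rfl
    | tail _ h ih => exact ih.trans (hM _ _ h).le
  have hnd : ∀ v, Iio v ⊆ M.graph.nonDescendants v := fun v u hu h => not_lt_of_ge (hle v u h) hu
  have hκ : IsNonanticipating M.piKernel := fun v B hB =>
    (M.measurable_piKernel v hB).mono (cylinderEvents_mono (hpa v)) le_rfl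
  have hone : ∀ v (B : Set (X v)) y, M.piKernel v y B ≤ 1 := fun v B y => prob_le_one
  constructor
  · refine fun h => ⟨inferInstance, fun v hv => absurd (mem_univ v) hv, fun v _ A hA B hB => ?_⟩
    obtain ⟨hind, hker⟩ := h v
    have hind' := hind ((fun x => x v) ⁻¹' B) A ⟨B, hB, rfl⟩ (by
      rw [← cylinderEvents_eq_comap_domRestrict]
      exact cylinderEvents_mono (hnd v) _ hA)
    have hker' := hker B hB
    rw [← cylinderEvents_eq_comap_domRestrict] at hind' hker'
    exact measure_inter_eq_setLIntegral_of_condExp cylinderEvents_le_pi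
      (measurable_pi_apply v hB) (M.measurable_piKernel v hB) (hone v B) hker'
      (cylinderEvents_le_pi _ hA) hind'
  · intro h v
    have hnd_inter : ∀ A, MeasurableSet[cylinderEvents (M.graph.nonDescendants v)] A →
        ∀ B : Set (X v), MeasurableSet B →
        μ (A ∩ (fun y => y v) ⁻¹' B) = ∫⁻ y in A, M.piKernel v y B ∂μ := fun A hA B hB => by
      refine h.inter_eval_of_forall_measurable hκ
        (D := M.graph.nonDescendants v) (fun hv => hv .refl) (fun w hw B hB => ?_) hA hB
      refine (M.measurable_piKernel w hB).mono (cylinderEvents_mono fun u hu => ⟨?_, hpa w hu⟩)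
        le_rfl
      exact fun hvu => hw (hvu.tail hu)
    have hpnd := cylinderEvents_mono (X := X) ((hpa v).trans (hnd v))
    refine ⟨?_, fun B hB => ?_⟩
    · rintro _ B ⟨A, hA, rfl⟩ hB
      rw [← cylinderEvents_eq_comap_domRestrict] at hB ⊢
      exact condExp_indicator_inter_ae_eq_mul hpnd cylinderEvents_le_pi (measurable_pi_apply v hA)
        (M.measurable_piKernel v hA) (hone v A) (fun C hC => hnd_inter C hC A hA) hB
    · rw [← cylinderEvents_eq_comap_domRestrict]
      exact toReal_ae_eq_condExp_indicator cylinderEvents_le_pi (measurable_pi_apply v hB)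
        (M.measurable_piKernel v hB) (hone v B) fun A hA => hnd_inter A (hpnd _ hA) B hB

theorem existsUnique_represents_of_adj_lt [LinearOrder V] [WellFoundedLT V] (M : MTBN V X)
    (hM : ∀ u v, M.graph.Adj u v → u < v) :
    ∃! μ : Measure (∀ v, X v), IsProbabilityMeasure μ ∧ M.Represents μ := by
  have hκ : IsNonanticipating M.piKernel := fun v B hB =>
    (M.measurable_piKernel v hB).mono (cylinderEvents_mono fun u hu => hM u v hu) le_rfl
  have x : ∀ v, X v := fun v => (M.nonempty_of_wellFounded v).some
  obtain ⟨Q, hQ⟩ := exists_kernel_isInterventionLaw hκ univ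
  have := (hQ x).isProbabilityMeasure
  refine ⟨Q x, ⟨this, (M.represents_iff_isInterventionLaw hM x).2 (hQ x)⟩, ?_⟩
  rintro μ ⟨hμ, hμM⟩
  refine Measure.ext fun A hA => ?_
  refine ((M.represents_iff_isInterventionLaw hM x).1 hμM).measure_eq hκ (hQ x) (D := univ)
    (fun _ _ => Iff.rfl) (fun _ _ _ => subset_univ _) ?_
  rwa [cylinderEvents_univ]

end MTBN

theorem theorem1 {V : Type*} {X : V → Type*} [∀ v, MeasurableSpace (X v)] (M : MTBN V X) :
    ∃! μ : Measure (∀ v, X v), IsProbabilityMeasure μ ∧ M.Represents μ := by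
  have : IsWellFounded V M.graph.Adj := ⟨M.wellFounded.wellFounded_adj⟩
  -- This order compares ranks first, so edges strictly increase.
  let _ := IsWellFounded.wellOrderExtension M.graph.Adj
  have : WellFoundedLT V := IsWellFounded.wellOrderExtension.isWellFounded_lt M.graph.Adj
  exact M.existsUnique_represents_of_adj_lt fun u v h =>
    Prod.Lex.left _ _ (IsWellFounded.rank_lt_of_rel h)
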